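/- Let $\Bbbk$ be a field and let $Q=(Q_0,Q_1)$ be a finite acyclic quiver. Let $G=(Q,R)$ be the associated fully commutative quiver, where $R$ consists of all differences $p_1-p_2$ of parallel paths of length at least $1$. A path of $Q$ is called non-zero if its class in $\Bbbk Q/\langle R\rangle$ is non-zero. Representations of $G$ are the finite-dimensional representations of $Q$ over $\Bbbk$ on which all relations in $R$ vanish. An interval $I$ of $G$ is a non-empty, connected, full subquiver of $Q$ that is convex, meaning that it contains every vertex of every non-zero path whose start and target lie in $I$, and whose induced relations include no zero relation $\lambda p$ with $\lambda\neq 0$. Its interval representation $V_I$ is $\Bbbk$ at the vertices of $I$ and $0$ at the other vertices, with the identity on the arrows between vertices of $I$ and $0$ on all other arrows. The essential vertices of $I$ are the vertices of $I$ that are sources or sinks in $I$. A course on $G$ is a pair $(C,F)$ of a finite connected quiver $C$ and a map $F\colon C_0\to Q_0$ such that for every arrow $c\to d$ of $C$ there is a path in $Q$ from $F(c)$ to $F(d)$. It is essential in $I$ if its image $F(C_0)$ is contained in $I_0$ and contains all essential vertices of $I$. An essential assignment $\xi$ assigns to each interval $I$ of $G$ a course $\xi(I)$ that is essential in $I$.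 For a course $(C,F)$, the tour $\operatorname{Tour}_{(C,F)}$ sends a representation $M$ of $G$ to the representation of the quiver $C$ with space $M_{F(c)}$ at each vertex $c$ and, on each arrow $c\to d$, the value of $M$ on any path in $Q$ from $F(c)$ to $F(d)$. The $\xi$-compressed multiplicity $c^{\xi}_M(I)$ is the multiplicity of $\operatorname{Tour}_{\xi(I)}(V_I)$ in the (Krull--Schmidt) decomposition of $\operatorname{Tour}_{\xi(I)}(M)$ into indecomposable representations of $C$. Let $p$ be a non-zero path in $G$ from a vertex $s$ to a vertex $t$, and let $B$ be the convex hull of $\{s,t\}$, i.e. the full subquiver of $Q$ on all vertices that lie on a non-zero path starting and ending in $\{s,t\}$; it is an interval of $G$. Then for every essential assignment $\xi$ and every representation $M$ of $G$, the multiplicity $c^{\xi}_M(B)$ is well defined and \[ c^{\xi}_M(B)=\operatorname{rank} M(p). \] -/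

import Mathlib

open CategoryTheory CategoryTheory.Limits

universe u v w v' w' v'' w''

/-! ### Quivers -/

/-- A vertex is a source if no arrow points toward it. -/
def Quiver.IsSourceVertex {V : Type v} [Quiver.{w} V] (a : V) : Prop :=
  ∀ b : V, IsEmpty (b ⟶ a)

/-- A vertex is a sink if no arrow originates from it. -/
def Quiver.IsSinkVertex {V : Type v} [Quiver.{w} V] (a : V) : Prop :=
  ∀ b : V, IsEmpty (a ⟶ b)

/-- A quiver is acyclic if every path from a vertex to itself is trivial. -/
def Quiver.IsAcyclic (V : Type v) [Quiver.{w} V] : Prop :=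
  ∀ (a : V) (c : Quiver.Path a a), c.length = 0

/-- A quiver is connected if it is nonempty and its underlying graph is connected. -/
def Quiver.IsConnected (V : Type v) [Quiver.{w} V] : Prop :=
  Nonempty V ∧ ∀ a b : V,
    Quiver.WeaklyConnectedComponent.mk a = Quiver.WeaklyConnectedComponent.mk b

/-- The full subquiver on a set `S` of vertices. -/
def Quiver.FullSubquiver {Q : Type v} [Quiver.{w} Q] (S : Set Q) : Type v := {a : Q // a ∈ S}

instance {Q : Type v} [Quiver.{w} Q] (S : Set Q) : Quiver.{w} (Quiver.FullSubquiver S) where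
  Hom a b := a.1 ⟶ b.1

/-- A path of `Q`, as a morphism of the category of paths of `Q`. -/
def Quiver.Path.hom {Q : Type v} [Quiver.{w} Q] {a b : Q} (p : Quiver.Path a b) :
    (Paths.of Q).obj a ⟶ (Paths.of Q).obj b := p

/-! ### Quivers with relations -/

/-- A set of relations in the quiver `Q` with coefficients in `k`: a set of linear combinations
of parallel paths of length at least one. -/
structure QuiverRelations (k : Type u) [Field k] (Q : Type v) [Quiver.{w} Q] where
  rel : ∀ a b : Q, Set (Quiver.Path a b →₀ k)
  one_le_length : ∀ {a b : Q} {ρ : Quiver.Path a b →₀ k}, ρ ∈ rel a b →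
    ∀ p ∈ ρ.support, 1 ≤ p.length

namespace QuiverRelations

variable {k : Type u} [Field k] {Q : Type v} [Quiver.{w} Q]

/-- The component, spanned by (classes of) paths from `a` to `b`, of the two-sided ideal of the
path algebra generated by the relations. -/
noncomputable def ideal (R : QuiverRelations k Q) (a b : Q) : Submodule k (Quiver.Path a b →₀ k) :=
  Submodule.span k {σ | ∃ (c d : Q) (x : Quiver.Path a c) (ρ : Quiver.Path c d →₀ k)
    (y : Quiver.Path d b), ρ ∈ R.rel c d ∧ σ = ρ.mapDomain (fun p => (x.comp p).comp y)}

/-- A path is non-zero in `(Q, R)` if its class in the quotient of the path algebra of `Q` by the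
ideal generated by `R` is not zero. -/
def IsNonzeroPath (R : QuiverRelations k Q) {a b : Q} (p : Quiver.Path a b) : Prop :=
  Finsupp.single p (1 : k) ∉ R.ideal a b

/-- `(Q, R)`-convexity of the full subquiver on `S`: every vertex of every non-zero path which
starts and ends in `S` is in `S`. -/
def IsConvex (R : QuiverRelations k Q) (S : Set Q) : Prop :=
  ∀ ⦃a b : Q⦄ (p : Quiver.Path a b), R.IsNonzeroPath p → a ∈ S → b ∈ S →
    ∀ c ∈ p.vertices, c ∈ S

/-- The vertex set of the convex hull of `S`: the vertices that lie on a non-zero path starting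
and ending in `S`. -/
def convexHull (R : QuiverRelations k Q) (S : Set Q) : Set Q :=
  {c | ∃ (a b : Q) (p : Quiver.Path a b),
    a ∈ S ∧ b ∈ S ∧ R.IsNonzeroPath p ∧ c ∈ p.vertices}

/-- The relations induced on the full subquiver on `S` contain no zero relation `μ p`, `μ ≠ 0`. -/
def NoZeroRelationIn (R : QuiverRelations k Q) (S : Set Q) : Prop :=
  ∀ ⦃a b : Q⦄ (p : Quiver.Path a b) (μ : k), μ ≠ 0 → (∀ c ∈ p.vertices, c ∈ S) →
    Finsupp.single p μ ∉ R.rel a b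

/-- An interval subquiver of `(Q, R)`. As it is a full subquiver, it is given by its vertices. -/
structure Interval (R : QuiverRelations k Q) where
  carrier : Set Q
  connected : Quiver.IsConnected (Quiver.FullSubquiver carrier)
  convex : R.IsConvex carrier
  noZeroRelation : R.NoZeroRelationIn carrier

/-- The essential vertices of an interval: its vertices which are sources or sinks in it. -/
def Interval.essentialVertices {R : QuiverRelations k Q} (I : R.Interval) : Set Q :=
  {a | ∃ h : a ∈ I.carrier,
    Quiver.IsSourceVertex (V := Quiver.FullSubquiver I.carrier) ⟨a, h⟩ ∨
    Quiver.IsSinkVertex (V := Quiver.FullSubquiver I.carrier) ⟨a, h⟩}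

/-- The evaluation of a representation of `Q` on a linear combination of parallel paths. -/
noncomputable def evalRel (M : Paths Q ⥤ FGModuleCat.{u} k) {a b : Q} (ρ : Quiver.Path a b →₀ k) :
    M.obj ((Paths.of Q).obj a) ⟶ M.obj ((Paths.of Q).obj b) :=
  ρ.sum fun p μ => μ • M.map p.hom

/-- The category of finite-dimensional representations of the quiver with relations `(Q, R)`:
representations of `Q` whose evaluation on each relation vanishes. -/
abbrev Representation (R : QuiverRelations k Q) :=
  ObjectProperty.FullSubcategory (C := Paths Q ⥤ FGModuleCat.{u} k)
    fun M => ∀ (a b : Q), ∀ ρ ∈ R.rel a b, evalRel M ρ = 0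

variable (k Q) in
/-- The full commutativity relations `p - q`, for parallel paths `p`, `q` of length at least
one. -/
noncomputable def fullCommutativity : QuiverRelations k Q where
  rel a b := {ρ | ∃ p q : Quiver.Path a b, 1 ≤ p.length ∧ 1 ≤ q.length ∧
    ρ = Finsupp.single p 1 - Finsupp.single q 1}
  one_le_length := by
    classical
    rintro a b ρ ⟨p, q, hp, hq, rfl⟩ r hr
    have := Finsupp.support_sub hr
    rcases Finset.mem_union.1 this with h | h
    · rw [Finset.mem_singleton.1 (Finsupp.support_single_subset h)]; exact hp
    · rw [Finset.mem_singleton.1 (Finsupp.support_single_subset h)]; exact hq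

/-- In a fully commutative quiver every path is non-zero: the sum of the coefficients vanishes on
the ideal of relations. -/
theorem isNonzeroPath_fullCommutativity {a b : Q} (p : Quiver.Path a b) :
    (fullCommutativity k Q).IsNonzeroPath p := by
  intro h
  let φ : (Quiver.Path a b →₀ k) →ₗ[k] k := Finsupp.linearCombination k fun _ => (1 : k)
  have hle : (fullCommutativity k Q).ideal a b ≤ LinearMap.ker φ := by
    refine Submodule.span_le.2 ?_
    rintro σ ⟨c, d, x, ρ, y, ⟨q, r, -, -, rfl⟩, rfl⟩
    change φ _ = 0
    rw [← Finsupp.lmapDomain_apply k k, map_sub]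
    simp [φ, Finsupp.lmapDomain_apply, Finsupp.mapDomain_single]
  have := hle h
  simp [φ] at this

end QuiverRelations

namespace FullyCommutativeQuiver

open QuiverRelations

variable {k : Type u} [Field k] {Q : Type v} [Quiver.{w} Q]

/-- In a fully commutative acyclic quiver, a representation takes the same value on any two
parallel paths. -/
theorem map_eq_map (hQ : Quiver.IsAcyclic Q) (M : (fullCommutativity k Q).Representation)
    {a b : Q} (p q : Quiver.Path a b) :
    M.obj.map p.hom = M.obj.map q.hom := by
  classical
  by_cases hab : a = b
  · subst hab
    rw [Quiver.Path.eq_nil_of_length_zero p (hQ a p),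
      Quiver.Path.eq_nil_of_length_zero q (hQ a q)]
  · have h1 : ∀ r : Quiver.Path a b, 1 ≤ r.length := fun r =>
      Nat.one_le_iff_ne_zero.2 fun h0 => hab (Quiver.Path.eq_of_length_zero r h0)
    have h := M.property a b _ ⟨p, q, h1 p, h1 q, rfl⟩
    rw [evalRel, Finsupp.sum_sub_index (by intros; rw [sub_smul]),
      Finsupp.sum_single_index (by simp), Finsupp.sum_single_index (by simp), one_smul,
      one_smul] at h
    exact sub_eq_zero.1 h

/-! ### Convex hulls of the ends of a path -/

theorem mem_vertices_comp {a b c : Q} (q : Quiver.Path a c) (r : Quiver.Path c b) :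
    c ∈ (q.comp r).vertices := by
  rw [Quiver.Path.vertices_comp]
  exact List.mem_append_right _ r.start_mem_vertices

theorem convexHull_isConvex (S : Set Q) :
    (fullCommutativity k Q).IsConvex ((fullCommutativity k Q).convexHull S) := by
  rintro a b p - ⟨a₁, b₁, p₁, ha₁, -, -, h₁⟩ ⟨a₂, b₂, p₂, -, hb₂, -, h₂⟩ c hc
  obtain ⟨x, -, -⟩ := p₁.exists_eq_comp_of_mem_vertices h₁
  obtain ⟨-, y, -⟩ := p₂.exists_eq_comp_of_mem_vertices h₂
  obtain ⟨q, r, rfl⟩ := p.exists_eq_comp_of_mem_vertices hc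
  exact ⟨a₁, b₂, (x.comp q).comp (r.comp y), ha₁, hb₂, isNonzeroPath_fullCommutativity _,
    mem_vertices_comp _ _⟩

theorem fullCommutativity_noZeroRelationIn (S : Set Q) :
    (fullCommutativity k Q).NoZeroRelationIn S := by
  intro a b p μ hμ _ hrel
  refine isNonzeroPath_fullCommutativity (k := k) p ?_
  have h : Finsupp.single p μ ∈ (fullCommutativity k Q).ideal a b := by
    refine Submodule.subset_span ⟨a, b, .nil, _, .nil, hrel, ?_⟩
    simp [Finsupp.mapDomain_single]
  have := Submodule.smul_mem _ μ⁻¹ h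
  simpa [Finsupp.smul_single, inv_mul_cancel₀ hμ] using this

/-- Two vertices joined by a path inside `S` are in the same component of the subquiver. -/
theorem component_eq_of_path (S : Set Q) {a b : Q} (p : Quiver.Path a b)
    (hp : ∀ c ∈ p.vertices, c ∈ S) (ha : a ∈ S) (hb : b ∈ S) :
    Quiver.WeaklyConnectedComponent.mk (V := Quiver.FullSubquiver S) ⟨a, ha⟩ =
      Quiver.WeaklyConnectedComponent.mk (V := Quiver.FullSubquiver S) ⟨b, hb⟩ := by
  induction p with
  | nil => rfl
  | @cons c d q e ih =>
    have hc : c ∈ S := hp c (by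
      rw [Quiver.Path.mem_vertices_cons]; exact Or.inl q.end_mem_vertices)
    refine (ih (fun x hx => hp x (by
      rw [Quiver.Path.mem_vertices_cons]; exact Or.inl hx)) hc).trans ?_
    refine (Quiver.WeaklyConnectedComponent.eq _ _).2 ⟨?_⟩
    exact Quiver.Hom.toPath
      (V := Quiver.Symmetrify (Quiver.FullSubquiver S)) (a := ⟨c, hc⟩) (b := ⟨d, hb⟩)
      (Sum.inl e)

/-- The convex hull of the start and the target of a non-zero path, as an interval. -/
def hullInterval {s t : Q} (p : Quiver.Path s t)
    (hp : (fullCommutativity k Q).IsNonzeroPath p) : (fullCommutativity k Q).Interval where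
  carrier := (fullCommutativity k Q).convexHull {s, t}
  connected := by
    set S := (fullCommutativity k Q).convexHull {s, t} with hS
    have hs : s ∈ S := ⟨s, t, p, by simp, by simp, hp, p.start_mem_vertices⟩
    have ht : t ∈ S := ⟨s, t, p, by simp, by simp, hp, p.end_mem_vertices⟩
    have key : ∀ a : Q, ∀ ha : a ∈ S,
        Quiver.WeaklyConnectedComponent.mk (V := Quiver.FullSubquiver S) ⟨s, hs⟩ =
          Quiver.WeaklyConnectedComponent.mk (V := Quiver.FullSubquiver S) ⟨a, ha⟩ := by
      rintro a ⟨b, c, q, hb, hc, hq, ha⟩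
      obtain ⟨x, y, rfl⟩ := q.exists_eq_comp_of_mem_vertices ha
      have hbS : b ∈ S := by rcases hb with rfl | rfl <;> assumption
      have hxS : ∀ z ∈ x.vertices, z ∈ S := fun z hz => by
        obtain ⟨x₁, x₂, rfl⟩ := x.exists_eq_comp_of_mem_vertices hz
        refine ⟨b, c, _, hb, hc, hq, ?_⟩
        rw [Quiver.Path.comp_assoc]
        exact mem_vertices_comp _ _
      have haS : a ∈ S := hxS a x.end_mem_vertices
      have hba := component_eq_of_path S x hxS hbS haS
      refine Eq.trans ?_ hba
      rcases hb with rfl | rfl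
      · rfl
      · exact component_eq_of_path S p
          (fun z hz => ⟨s, _, p, by simp, by simp, hp, hz⟩) hs ht
    exact ⟨⟨⟨s, hs⟩⟩, fun a b => (key a.1 a.2).symm.trans (key b.1 b.2)⟩
  convex := convexHull_isConvex _
  noZeroRelation := fullCommutativity_noZeroRelationIn _

/-! ### Interval representations -/

/-- The linear map between `k` or `0` at two vertices: the identity of `k` if both vertices are
in `S`, and zero otherwise. The space `PLift (a ∈ S) → k` is a copy of `k` if `a ∈ S`, and is
zero otherwise. -/
noncomputable def indicatorMap (k : Type u) [Field k] (S : Set Q) (a b : Q) :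
    (PLift (a ∈ S) → k) →ₗ[k] (PLift (b ∈ S) → k) :=
  open Classical in
  if h : a ∈ S then LinearMap.pi fun _ => LinearMap.proj ⟨h⟩ else 0

/-- The representation of the quiver `Q` with `k` at the vertices of `S` and `0` elsewhere, and
with the identity on the arrows between vertices of `S` and zero on the other arrows. -/
noncomputable def indicatorFunctor (k : Type u) [Field k] (S : Set Q) :
    Paths Q ⥤ FGModuleCat.{u} k :=
  Paths.lift
    { obj := fun a => FGModuleCat.of k (PLift (a ∈ S) → k)
      map := fun {a b} _ => FGModuleCat.ofHom (indicatorMap k S a b) }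

theorem indicatorFunctor_map {S : Set Q} (hS : (fullCommutativity k Q).IsConvex S) {a b : Q}
    (p : Quiver.Path a b) :
    (indicatorFunctor k S).map p.hom =
      FGModuleCat.ofHom (indicatorMap k S a b) := by
  induction p with
  | nil =>
    refine FGModuleCat.hom_ext (LinearMap.ext fun (f : PLift (a ∈ S) → k) =>
      funext fun (h : PLift (a ∈ S)) => ?_)
    change f h = indicatorMap k S a a f h
    rw [indicatorMap, dif_pos h.down]; rfl
  | @cons c d q e ih =>
    have h0 : (indicatorFunctor k S).map (q.cons e).hom = (indicatorFunctor k S).map q.hom ≫ FGModuleCat.ofHom (indicatorMap k S c d) := rfl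
    rw [h0, ih]
    refine FGModuleCat.hom_ext (LinearMap.ext fun (f : PLift (a ∈ S) → k) =>
      funext fun (h : PLift (d ∈ S)) => ?_)
    change indicatorMap k S c d (indicatorMap k S a c f) h = indicatorMap k S a d f h
    by_cases ha : a ∈ S
    · have hc : c ∈ S := hS (q.cons e) (isNonzeroPath_fullCommutativity _) ha h.down c
        ((Quiver.Path.mem_vertices_cons _ _).2 (Or.inl q.end_mem_vertices))
      simp only [indicatorMap, dif_pos ha, dif_pos hc]
      rfl
    · simp only [indicatorMap, dif_neg ha, map_zero, LinearMap.zero_apply]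

/-- The interval representation `V_I`. -/
noncomputable def intervalRepresentation (I : (fullCommutativity k Q).Interval) :
    (fullCommutativity k Q).Representation where
  obj := indicatorFunctor k I.carrier
  property := by
    rintro a b ρ ⟨p, q, -, -, rfl⟩
    classical
    rw [evalRel, Finsupp.sum_sub_index (by intros; rw [sub_smul]),
      Finsupp.sum_single_index (by simp), Finsupp.sum_single_index (by simp),
      indicatorFunctor_map I.convex p, indicatorFunctor_map I.convex q, sub_self]

/-! ### Courses and tours -/

/-- A course on `Q`: a finite connected quiver `C` with a labeling of its vertices by those of
`Q`, such that for each arrow of `C` there is a path in `Q` between the labels of its ends. -/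
structure Course (Q : Type v) [Quiver.{w} Q] where
  C : Type v'
  [quiver : Quiver.{w'} C]
  [finite : Finite C]
  connected : Quiver.IsConnected C
  label : C → Q
  exists_path : ∀ {c d : C}, (c ⟶ d) → Nonempty (Quiver.Path (label c) (label d))

attribute [instance] Course.quiver Course.finite

/-- A course is essential in an interval `I` if its labels lie in `I` and include every
essential vertex of `I`. -/
def Course.IsEssentialIn (X : Course.{v, w, v', w'} Q) {R : QuiverRelations k Q}
    (I : R.Interval) : Prop :=
  I.essentialVertices ⊆ Set.range X.label ∧ Set.range X.label ⊆ I.carrier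

/-- An essential assignment: the choice of an essential course in each interval. -/
structure EssentialAssignment (R : QuiverRelations k Q) where
  course : R.Interval → Course.{v, w, v', w'} Q
  isEssentialIn : ∀ I : R.Interval, (course I).IsEssentialIn I

/-- The tour of a course, from the representations of a fully commutative quiver to those of the
quiver `C` of the course. An arrow `c ⟶ d` of `C` is sent to the value of `M` on a path from the
label of `c` to that of `d`, which by `map_eq_map` does not depend on the path. -/
noncomputable def tour (X : Course.{v, w, v', w'} Q) :
    (fullCommutativity k Q).Representation ⥤ (Paths X.C ⥤ FGModuleCat.{u} k) where
  obj M := Paths.lift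
    { obj := fun c => M.obj.obj ((Paths.of Q).obj (X.label c))
      map := fun {c d} α => M.obj.map (X.exists_path α).some.hom }
  map {M N} f := Paths.liftNatTrans
    (fun c => f.hom.app ((Paths.of Q).obj (X.label c))) (by
      intro c d α
      rw [Paths.lift_toPath, Paths.lift_toPath]
      exact f.hom.naturality _)
  map_id M := by
    ext c : 2
    rfl
  map_comp f g := by
    ext c : 2
    rfl

end FullyCommutativeQuiver

/-! ### Multiplicities -/

instance (k : Type u) [Field k] : HasFiniteBiproducts (FGModuleCat.{u} k) :=
  HasFiniteBiproducts.of_hasFiniteProducts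

instance (k : Type u) [Field k] (C : Type v) [Category.{w} C] :
    HasFiniteBiproducts (C ⥤ FGModuleCat.{u} k) :=
  HasFiniteBiproducts.of_hasFiniteProducts

section Multiplicity

variable {A : Type v} [Category.{w} A] [HasZeroMorphisms A] [HasBinaryBiproducts A]
  [HasFiniteBiproducts A]

/-- `N` is the list of summands of a decomposition of `M` into indecomposables. -/
def IsIndecomposableDecomposition (M : A) {m : ℕ} (N : Fin m → A) : Prop :=
  (∀ i, Indecomposable (N i)) ∧ Nonempty (M ≅ ⨁ N)

/-- `L` has Krull-Schmidt multiplicity `n` in `M`: there is a decomposition of `M` as a finite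
direct sum of indecomposables, and in every such decomposition exactly `n` summands are
isomorphic to `L`. -/
def HasMultiplicity (M L : A) (n : ℕ) : Prop :=
  (∃ (m : ℕ) (N : Fin m → A), IsIndecomposableDecomposition M N) ∧
    ∀ (m : ℕ) (N : Fin m → A), IsIndecomposableDecomposition M N →
      Nat.card {i : Fin m // Nonempty (N i ≅ L)} = n

open Classical in
/-- The multiplicity of `L` in `M` (and `0` if it is not well-defined). -/
noncomputable def multiplicityOf (M L : A) : ℕ :=
  if h : ∃ n, HasMultiplicity M L n then h.choose else 0

end Multiplicity

namespace FullyCommutativeQuiver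

open QuiverRelations

variable {k : Type u} [Field k] {Q : Type v} [Quiver.{w} Q]

/-- The `ξ`-compressed multiplicity of `M` on the interval `I`. -/
noncomputable def compressedMultiplicity
    (ξ : EssentialAssignment.{u, v, w, v', w'} (fullCommutativity k Q))
    (M : (fullCommutativity k Q).Representation) (I : (fullCommutativity k Q).Interval) : ℕ :=
  multiplicityOf ((tour (ξ.course I)).obj M)
    ((tour (ξ.course I)).obj (intervalRepresentation I))

/-- The rank of the linear map `M(p)`. -/
noncomputable def pathRank (M : (fullCommutativity k Q).Representation) {s t : Q}
    (p : Quiver.Path s t) : ℕ :=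
  Module.finrank k (LinearMap.range
    (M.obj.map p.hom).hom.hom)

end FullyCommutativeQuiver

open QuiverRelations FullyCommutativeQuiver

/-! ### Existence of decompositions, and retracts of indecomposable objects -/

section Decomposition

variable {A : Type v} [Category.{w} A] [Preadditive A] [HasBinaryBiproducts A]
  [HasFiniteBiproducts A]

/-! The labels of the course lie in the hull `B`, so the tour of `V_B` is isomorphic to the constant
representation `L = k` of the connected quiver `C`, and `End(L) = k`. In any decomposition of `N`
into indecomposables, the number of summands isomorphic to `L` is the rank of the composition
pairing `Hom(L, N) × Hom(N, L) → End(L) = k`: a summand isomorphic to `L` contributes rank one, any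
other contributes zero, as otherwise `L` would be a retract of it. The count is therefore the same
in all decompositions, without appeal to the Krull-Schmidt theorem
(`card_summands_eq_finrank_range`).

For `N` the tour of `M`, acyclicity makes `s` and `t` essential in `B`, so they label vertices `a`,
`b` of `C`. Every label is reached from `s` and reaches `t`, so the values of `M` on paths form a
cone from `N_a` to `N` and a cocone from `N` to `N_b`, with composite `M(p)`. An endomorphism of `L`
is known from one vertex, so composites `L ⟶ N ⟶ L` may be computed through the cone and the cocone;
the pairing becomes `(v, φ) ↦ φ (M(p) v)`, of rank `rank M(p)` (`hasMultiplicity_const`). -/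

/-- A biproduct over a disjoint union is the biproduct of the two biproducts. -/
theorem nonempty_biproduct_sum_iso {α β : Type} [Fintype α] [Fintype β] (F : α ⊕ β → A) :
    Nonempty ((⨁ fun a => F (.inl a)) ⊞ (⨁ fun b => F (.inr b)) ≅ ⨁ F) := by
  classical
  refine ⟨⟨biprod.desc (biproduct.desc fun a => biproduct.ι F (.inl a))
      (biproduct.desc fun b => biproduct.ι F (.inr b)),
    biprod.lift (biproduct.lift fun a => biproduct.π F (.inl a))
      (biproduct.lift fun b => biproduct.π F (.inr b)), ?_, ?_⟩⟩
  · ext i j <;> simp [biproduct.ι_π]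
  · rw [biprod.lift_desc, biproduct.lift_desc, biproduct.lift_desc, ← biproduct.total,
      Fintype.sum_sum_type]

/-- If a measure of size is additive on decompositions and vanishes only on zero objects, then
every object is a finite biproduct of indecomposables. -/
theorem exists_indecomposableDecomposition (d : A → ℕ)
    (hadd : ∀ N X Y : A, (N ≅ X ⊞ Y) → d N = d X + d Y)
    (hzero : ∀ X : A, d X = 0 → IsZero X) (M : A) :
    ∃ (m : ℕ) (N : Fin m → A), IsIndecomposableDecomposition M N := by
  -- Arbitrary finite index types let two decompositions be joined over a disjoint union; the
  -- passage to `Fin m` is made once.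
  suffices h : ∀ (n : ℕ) (M : A), d M = n → ∃ (ι : Type) (_ : Fintype ι) (N : ι → A),
      (∀ i, Indecomposable (N i)) ∧ Nonempty (M ≅ ⨁ N) by
    obtain ⟨ι, _, N, hN, ⟨e⟩⟩ := h _ M rfl
    exact ⟨_, fun i => N ((Fintype.equivFin ι).symm i), fun i => hN _,
      ⟨e ≪≫ (biproduct.whiskerEquiv (Fintype.equivFin ι).symm fun _ => Iso.refl _).symm⟩⟩
  intro n
  induction n using Nat.strong_induction_on with
  | _ n ih =>
    rintro M rfl
    by_cases h0 : IsZero M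
    · exact ⟨Empty, inferInstance, fun e => e.elim, fun e => e.elim,
        ⟨h0.iso ((IsZero.iff_id_eq_zero _).2 (biproduct.hom_ext _ _ fun e => e.elim))⟩⟩
    by_cases hi : Indecomposable M
    · exact ⟨Unit, inferInstance, fun _ => M, fun _ => hi, ⟨(biproductUniqueIso fun _ => M).symm⟩⟩
    · simp only [Indecomposable, not_and, not_forall, not_or] at hi
      obtain ⟨X, Y, e, hX, hY⟩ := hi h0
      have h := hadd M X Y e
      -- Neither part has size zero, so both are strictly smaller than `M`.
      have hX' : d X ≠ 0 := fun h => hX (hzero X h)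
      have hY' : d Y ≠ 0 := fun h => hY (hzero Y h)
      obtain ⟨α, _, F, hF, ⟨f⟩⟩ := ih (d X) (by omega) X rfl
      obtain ⟨β, _, G, hG, ⟨g⟩⟩ := ih (d Y) (by omega) Y rfl
      obtain ⟨s⟩ := nonempty_biproduct_sum_iso (Sum.elim F G)
      exact ⟨α ⊕ β, inferInstance, Sum.elim F G, by rintro (i | i); exacts [hF i, hG i],
        ⟨e ≪≫ biprod.mapIso f g ≪≫ s⟩⟩

omit [HasFiniteBiproducts A] in
/-- A nonzero retract of an indecomposable object is isomorphic to it. -/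
theorem CategoryTheory.Indecomposable.nonempty_iso_of_retract [IsIdempotentComplete A] {X L : A}
    (hX : Indecomposable X) (hL : ¬ IsZero L) (f : L ⟶ X) (r : X ⟶ L) (h : f ≫ r = 𝟙 L) :
    Nonempty (X ≅ L) := by
  -- The idempotent complementary to `r ≫ f` splits off a complement `Z`, so that `X ≅ L ⊞ Z`;
  -- indecomposability then forces `Z = 0`.
  obtain ⟨Z, i, q, hiq, hqi⟩ := IsIdempotentComplete.idempotents_split X (𝟙 X - r ≫ f)
    (by simp [Preadditive.sub_comp, Preadditive.comp_sub, reassoc_of% h])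
  have hir : i ≫ r = 0 := by
    have : i = i ≫ (𝟙 X - r ≫ f) := by rw [← hqi, reassoc_of% hiq]
    rw [this]
    simp [Preadditive.sub_comp, Preadditive.comp_sub, h]
  have hfq : f ≫ q = 0 := by
    have : q = (𝟙 X - r ≫ f) ≫ q := by rw [← hqi, Category.assoc, hiq, Category.comp_id]
    rw [this]
    simp [Preadditive.sub_comp, Preadditive.comp_sub, reassoc_of% h]
  let e : X ≅ L ⊞ Z :=
    ⟨biprod.lift r q, biprod.desc f i, by simp [biprod.lift_desc, hqi],
      by ext <;> simp [h, hiq, hir, hfq]⟩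
  rcases hX.2 L Z e with h' | h'
  · exact (hL h').elim
  · refine ⟨⟨r, f, ?_, h⟩⟩
    rw [h'.eq_of_tgt q 0, zero_comp] at hqi
    exact (sub_eq_zero.1 hqi.symm).symm

/-- If the multiplicity is well defined, it is the value of `multiplicityOf`. -/
theorem hasMultiplicity_multiplicityOf {M L : A} {n : ℕ} (h : HasMultiplicity M L n) :
    HasMultiplicity M L (multiplicityOf M L) ∧ multiplicityOf M L = n := by
  have hex : ∃ n, HasMultiplicity M L n := ⟨n, h⟩
  have heq : multiplicityOf M L = hex.choose := dif_pos hex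
  -- Both candidate values count the summands of this one decomposition, hence agree.
  obtain ⟨m, N, hN⟩ := h.1
  refine ⟨heq ▸ hex.choose_spec, ?_⟩
  rw [heq, ← hex.choose_spec.2 m N hN, h.2 m N hN]

end Decomposition

/-! ### Multiplicity as the rank of the composition pairing -/

section LinearCategory

variable {k : Type u} [Field k] {A : Type v} [Category.{w} A] [Preadditive A] [Linear k A]
  [HasBinaryBiproducts A] [HasFiniteBiproducts A] [IsIdempotentComplete A]

/-- Let `L` be an object with endomorphism ring `k`, and suppose that the composition pairing
`Hom(L, N) × Hom(N, L) → End(L)` factors through the pairing `(v, φ) ↦ φ (T v)` of a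
linear map `T` between finite-dimensional spaces. Then any decomposition of `N` into
indecomposables has exactly `rank T` summands isomorphic to `L`. -/
theorem card_summands_eq_finrank_range {V W : Type u} [AddCommGroup V] [Module k V]
    [AddCommGroup W] [Module k W] [FiniteDimensional k W] (T : V →ₗ[k] W)
    {L N : A} (hL : ¬ IsZero L) (hend : ∀ f : L ⟶ L, ∃ c : k, f = c • 𝟙 L)
    (α : V → (L ⟶ N)) (β : Module.Dual k W → (N ⟶ L))
    (ev : (L ⟶ N) → V) (coev : (N ⟶ L) → Module.Dual k W)
    (hev : ∀ (f : L ⟶ N) (g : N ⟶ L), f ≫ g = α (ev f) ≫ g) (hcoev : ∀ (f : L ⟶ N) (g : N ⟶ L), f ≫ g = f ≫ β (coev g))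
    (hαβ : ∀ v φ, α v ≫ β φ = φ (T v) • 𝟙 L)
    {m : ℕ} {F : Fin m → A} (hF : IsIndecomposableDecomposition N F) :
    Nat.card {i : Fin m // Nonempty (F i ≅ L)} = Module.finrank k (LinearMap.range T) := by
  classical
  obtain ⟨hind, ⟨e⟩⟩ := hF
  have hid : 𝟙 L ≠ 0 := fun h => hL ((IsZero.iff_id_eq_zero L).2 h)
  have hinj : ∀ {a b : k}, a • 𝟙 L = b • 𝟙 L → a = b := fun h => smul_left_injective k hid h
  set J := {i : Fin m // Nonempty (F i ≅ L)}
  let σ : ∀ j : J, F j.1 ≅ L := fun j => j.2.some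
  let inc : J → (L ⟶ N) := fun j => (σ j).inv ≫ biproduct.ι F j.1 ≫ e.inv
  let prj : J → (N ⟶ L) := fun j => e.hom ≫ biproduct.π F j.1 ≫ (σ j).hom
  -- These vectors, one per summand isomorphic to `L`, will form a basis of the range of `T`.
  let x : J → W := fun j => T (ev (inc j))
  have hpair : ∀ f g, f ≫ g = coev g (T (ev f)) • 𝟙 L := fun f g => by
    rw [hev, hcoev, hαβ]
  have hone : ∀ j, inc j ≫ prj j = 𝟙 L := fun j => by
    simp [inc, prj]
  have hne : ∀ i j, i ≠ j → inc i ≫ prj j = 0 := fun i j h => by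
    have h' : i.1 ≠ j.1 := fun h' => h (Subtype.ext h')
    simp [inc, prj, biproduct.ι_π_ne_assoc F h']
  -- The functionals `coev (prj j)` are dual to the family `x`.
  have hli : LinearIndependent k x := by
    rw [Fintype.linearIndependent_iff]
    intro g hg j
    have h := congrArg (coev (prj j)) hg
    rw [map_sum, map_zero, Finset.sum_eq_single j] at h
    · have h1 : coev (prj j) (x j) = 1 := hinj (by rw [← hpair, hone, one_smul])
      simpa [h1] using h
    · intro i _ hij
      have h1 : coev (prj j) (x i) = 0 := hinj (by rw [← hpair, hne i j hij, zero_smul])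
      simp [h1]
    · simp
  -- A nonzero composite would be an invertible scalar, making `L` a retract of `F i`.
  have hoff : ∀ i, ¬ Nonempty (F i ≅ L) → ∀ (f : L ⟶ F i) (g : F i ⟶ L), f ≫ g = 0 := by
    intro i hi f g
    obtain ⟨c, hc⟩ := hend (f ≫ g)
    by_cases h0 : c = 0
    · rw [hc, h0, zero_smul]
    · exact (hi ((hind i).nonempty_iso_of_retract hL f (c⁻¹ • g) (by
        rw [Linear.comp_smul, hc, smul_smul, inv_mul_cancel₀ h0, one_smul]))).elim
  have hspan : Submodule.span k (Set.range x) = LinearMap.range T := by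
    refine le_antisymm (Submodule.span_le.2 (by rintro _ ⟨j, rfl⟩; exact ⟨_, rfl⟩)) ?_
    rintro _ ⟨v, rfl⟩
    -- The coordinates of `T v` are read off from the components of `α v` in the summands isomorphic
    -- to `L`; the identity is tested against each functional `φ` by inserting the decomposition of
    -- `𝟙 N` into `α v ≫ β φ`.
    choose c hc using fun j : J => hend (α v ≫ prj j)
    have hT : T v = ∑ j, c j • x j := by
      rw [← sub_eq_zero, ← Module.forall_dual_apply_eq_zero_iff k]
      intro φ
      rw [map_sub, sub_eq_zero]
      refine hinj ?_
      have htot : α v ≫ β φ = ∑ i, (α v ≫ e.hom ≫ biproduct.π F i) ≫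
          (biproduct.ι F i ≫ e.inv ≫ β φ) := by
        have : 𝟙 N = ∑ i, (e.hom ≫ biproduct.π F i) ≫ (biproduct.ι F i ≫ e.inv) := by
          simp only [Category.assoc, ← Preadditive.comp_sum]
          simp only [← Category.assoc, ← Preadditive.sum_comp]
          simp only [Category.assoc]
          simp [biproduct.total]
        have h2 := congrArg (fun f => α v ≫ f ≫ β φ) this
        simpa [Preadditive.sum_comp, Preadditive.comp_sum] using h2
      rw [← hαβ, htot, ← Finset.sum_filter_add_sum_filter_not Finset.univ
        (fun i => Nonempty (F i ≅ L)), Finset.sum_eq_zero (s := Finset.univ.filter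
          fun i => ¬ Nonempty (F i ≅ L)) (fun i hi => hoff i (Finset.mem_filter.1 hi).2 _ _),
        add_zero, ← Finset.sum_subtype_eq_sum_filter, map_sum, Finset.sum_smul,
        Finset.subtype_univ]
      refine Finset.sum_congr rfl fun j _ => ?_
      have h1 : (α v ≫ e.hom ≫ biproduct.π F j.1) ≫ (biproduct.ι F j.1 ≫ e.inv ≫ β φ) =
          (α v ≫ prj j) ≫ (inc j ≫ β φ) := by
        simp [prj, inc]
      rw [h1, hc, hev (inc j), hαβ, map_smul, Linear.smul_comp, Category.id_comp, smul_eq_mul, mul_smul]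
    rw [hT]
    exact Submodule.sum_mem _ fun j _ =>
      Submodule.smul_mem _ _ (Submodule.subset_span ⟨j, rfl⟩)
  rw [← hspan, finrank_span_eq_card hli, Nat.card_eq_fintype_card]

end LinearCategory

/-! ### Representations of a finite quiver and the constant representation -/

section QuiverRepresentations

variable {k : Type u} [Field k] {C : Type v} [Quiver.{w} C]

/-- The total dimension of representations of a finite quiver is additive. -/
theorem sum_finrank_eq_of_iso_biprod [Fintype C] {N X Y : Paths C ⥤ FGModuleCat.{u} k}
    (e : N ≅ X ⊞ Y) :
    ∑ c : C, Module.finrank k (N.obj ((Paths.of C).obj c)) =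
      ∑ c : C, Module.finrank k (X.obj ((Paths.of C).obj c)) +
        ∑ c : C, Module.finrank k (Y.obj ((Paths.of C).obj c)) := by
  rw [← Finset.sum_add_distrib]
  refine Finset.sum_congr rfl fun c _ => ?_
  set a := (Paths.of C).obj c
  -- The biproduct identities, transported to `N` along `e` and evaluated at `a`, exhibit `N_a` as
  -- `X_a × Y_a`.
  have hX : (biprod.inl ≫ e.inv) ≫ (e.hom ≫ biprod.fst) = 𝟙 X := by simp
  have hY : (biprod.inr ≫ e.inv) ≫ (e.hom ≫ biprod.snd) = 𝟙 Y := by simp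
  have hXY : (biprod.inl ≫ e.inv) ≫ (e.hom ≫ biprod.snd) = (0 : X ⟶ Y) := by simp
  have hYX : (biprod.inr ≫ e.inv) ≫ (e.hom ≫ biprod.fst) = (0 : Y ⟶ X) := by simp
  have hN : (e.hom ≫ biprod.fst) ≫ (biprod.inl ≫ e.inv) +
      (e.hom ≫ biprod.snd) ≫ (biprod.inr ≫ e.inv) = 𝟙 N := by
    rw [Category.assoc, Category.assoc, ← Preadditive.comp_add, ← Category.assoc biprod.fst,
      ← Category.assoc biprod.snd, ← Preadditive.add_comp, biprod.total, Category.id_comp,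
      e.hom_inv_id]
  generalize (biprod.inl ≫ e.inv : X ⟶ N) = i at *
  generalize (biprod.inr ≫ e.inv : Y ⟶ N) = j at *
  generalize (e.hom ≫ biprod.fst : N ⟶ X) = p at *
  generalize (e.hom ≫ biprod.snd : N ⟶ Y) = q at *
  have lin {Z Z' : Paths C ⥤ FGModuleCat.{u} k} {f g : Z ⟶ Z'} (h : f = g) :
      (f.app a).hom.hom = (g.app a).hom.hom := by rw [h]
  have h1 := lin hX
  have h2 := lin hY
  have h3 := lin hXY
  have h4 := lin hYX
  have h5 := lin hN
  rw [← Module.finrank_prod]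
  refine LinearEquiv.finrank_eq (LinearEquiv.ofLinearMap
    ((p.app a).hom.hom.prod (q.app a).hom.hom)
    ((i.app a).hom.hom.coprod (j.app a).hom.hom) ?_ ?_)
  · refine LinearMap.prod_ext (LinearMap.ext fun x => ?_) (LinearMap.ext fun y => ?_)
    · exact Prod.ext (by simpa using LinearMap.congr_fun h1 x)
        (by simpa using LinearMap.congr_fun h3 x)
    · exact Prod.ext (by simpa using LinearMap.congr_fun h4 y)
        (by simpa using LinearMap.congr_fun h2 y)
  · exact LinearMap.ext fun x => LinearMap.congr_fun h5 x

/-- Representations of total dimension zero are zero. -/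
theorem isZero_of_sum_finrank_eq_zero [Fintype C] {N : Paths C ⥤ FGModuleCat.{u} k}
    (h : ∑ c : C, Module.finrank k (N.obj ((Paths.of C).obj c)) = 0) : IsZero N := by
  rw [IsZero.iff_id_eq_zero]
  ext c : 2
  have hc : Module.finrank k (N.obj ((Paths.of C).obj c)) = 0 :=
    Finset.sum_eq_zero_iff.1 h c (Finset.mem_univ _)
  have := Module.finrank_zero_iff.1 hc
  refine FGModuleCat.hom_ext (LinearMap.ext fun x => ?_)
  exact Subsingleton.elim (α := N.obj ((Paths.of C).obj c)) _ _

/-- A morphism of constant representations of a connected quiver has the same component at any two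
vertices. -/
theorem app_eq_app_of_isConnected {D : Type v'} [Category.{w'} D]
    (hC : Quiver.IsConnected C) {X Y : D}
    (f : (Functor.const (Paths C)).obj X ⟶ (Functor.const (Paths C)).obj Y) (c d : C) :
    (f.app ((Paths.of C).obj c) : X ⟶ Y) = f.app ((Paths.of C).obj d) := by
  -- Both transition maps are identities, so naturality is equality of components; connectedness
  -- carries this along zigzags.
  have harrow : ∀ {a b : C} (_ : a ⟶ b),
      (f.app ((Paths.of C).obj a) : X ⟶ Y) = f.app ((Paths.of C).obj b) := fun e => by
    exact (Category.comp_id (X := X) (Y := Y) _).symm.trans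
      ((f.naturality ((Paths.of C).map e)).symm.trans (Category.id_comp (X := X) (Y := Y) _))
  obtain ⟨q⟩ := (Quiver.WeaklyConnectedComponent.eq c d).1 (hC.2 c d)
  induction q with
  | nil => rfl
  | cons q e ih =>
    refine ih.trans ?_
    rcases e with e | e
    · exact harrow e
    · exact (harrow e).symm

/-- If a representation `N` of a finite connected quiver admits a cone with vertex the space at
`a` and a cocone with vertex the space at `b`, each with an identity leg, then the multiplicity
in `N` of the constant representation `k` is the rank of the composite `T` of the cone and the
cocone. -/
theorem hasMultiplicity_const [Finite C] (hC : Quiver.IsConnected C)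
    (N : Paths C ⥤ FGModuleCat.{u} k) (a b : C)
    (T : N.obj ((Paths.of C).obj a) ⟶ N.obj ((Paths.of C).obj b))
    (i : (Functor.const (Paths C)).obj (N.obj ((Paths.of C).obj a)) ⟶ N)
    (j : N ⟶ (Functor.const (Paths C)).obj (N.obj ((Paths.of C).obj b)))
    (hi : i.app ((Paths.of C).obj a) = 𝟙 _) (hj : j.app ((Paths.of C).obj b) = 𝟙 _)
    (hij : i ≫ j = (Functor.const (Paths C)).map T) :
    HasMultiplicity N ((Functor.const (Paths C)).obj (FGModuleCat.of k k))
      (Module.finrank k (LinearMap.range T.hom.hom)) := by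
  have := Fintype.ofFinite C
  refine ⟨exists_indecomposableDecomposition _ (fun _ _ _ => sum_finrank_eq_of_iso_biprod)
    (fun _ => isZero_of_sum_finrank_eq_zero) N, fun m F hF => ?_⟩
  -- An endomorphism of the constant representation is determined by the image of `1` at any single
  -- vertex.
  have hext (f g : (Functor.const (Paths C)).obj (FGModuleCat.of k k) ⟶
      (Functor.const (Paths C)).obj (FGModuleCat.of k k)) (c : C)
      (h : (f.app ((Paths.of C).obj c)).hom.hom (1 : k) =
        (g.app ((Paths.of C).obj c)).hom.hom (1 : k)) : f = g := by
    ext d : 2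
    refine (app_eq_app_of_isConnected hC f d c).trans
      (Eq.trans ?_ (app_eq_app_of_isConnected hC g c d))
    exact FGModuleCat.hom_ext (LinearMap.ext_ring h)
  refine card_summands_eq_finrank_range T.hom.hom ?_ ?_
    (fun v => (Functor.const (Paths C)).map
      (FGModuleCat.ofHom (LinearMap.toSpanSingleton k _ v)) ≫ i)
    (fun φ => j ≫ (Functor.const (Paths C)).map
      (FGModuleCat.ofHom (W := FGModuleCat.of k k) φ))
    (fun f => (f.app ((Paths.of C).obj a)).hom.hom (1 : k))
    (fun g => (g.app ((Paths.of C).obj b)).hom.hom) ?_ ?_ ?_ hF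
  · intro h
    have h1 := (IsZero.iff_id_eq_zero _).1 h
    have h2 := LinearMap.congr_fun
      (congrArg (fun f => (f.app ((Paths.of C).obj a)).hom.hom) h1) (1 : k)
    exact one_ne_zero (α := k) h2
  · intro f
    refine ⟨(f.app ((Paths.of C).obj a)).hom.hom (1 : k), hext _ _ a ?_⟩
    exact (mul_one (M := k) _).symm
  -- The map `f` need not factor through the cone; only its composite with `g` is compared, at `a`,
  -- where the cone leg is the identity. The dual identity is checked at `b`.
  · intro f g
    refine hext _ _ a ?_
    simp [hi]
    exact congrArg (g.app ((Paths.of C).obj a)).hom.hom (one_smul k _).symm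
  · intro f g
    refine hext _ _ b ?_
    simp [hj]
  · intro v φ
    refine hext _ _ a ?_
    rw [Category.assoc, reassoc_of% hij, ← Functor.map_comp, ← Functor.map_comp]
    change φ (T.hom.hom ((1 : k) • v)) = φ (T.hom.hom v) * 1
    rw [one_smul, mul_one]

end QuiverRepresentations

/-! ### Tours over the convex hull of a path -/

section Tours

variable {k : Type u} [Field k] {Q : Type v} [Quiver.{w} Q]

/-- Multiplicities do not depend on the representative of the isomorphism class. -/
theorem HasMultiplicity.of_iso {A : Type v} [Category.{w} A] [HasZeroMorphisms A]
    [HasBinaryBiproducts A] [HasFiniteBiproducts A] {M L L' : A} {n : ℕ}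
    (h : HasMultiplicity M L n) (e : L ≅ L') : HasMultiplicity M L' n := by
  refine ⟨h.1, fun m N hN => ?_⟩
  rw [← h.2 m N hN]
  have : ∀ i, Nonempty (N i ≅ L') ↔ Nonempty (N i ≅ L) := fun i =>
    ⟨fun ⟨f⟩ => ⟨f ≪≫ e.symm⟩, fun ⟨f⟩ => ⟨f ≪≫ e⟩⟩
  simp only [this]

/-- The tour of an interval representation along a course in the interval is constant. -/
theorem nonempty_tour_intervalRepresentation_iso (I : (fullCommutativity k Q).Interval)
    (X : Course.{v, w, v', w'} Q) (hX : Set.range X.label ⊆ I.carrier) :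
    Nonempty ((Functor.const (Paths X.C)).obj (FGModuleCat.of k k) ≅
      (tour X).obj (intervalRepresentation I)) := by
  have hc (c : X.C) : X.label c ∈ I.carrier := hX ⟨c, rfl⟩
  let e (c : X.C) : FGModuleCat.of k k ≅
      FGModuleCat.of k (PLift (X.label c ∈ I.carrier) → k) :=
    haveI : Unique (PLift (X.label c ∈ I.carrier)) := ⟨⟨⟨hc c⟩⟩, fun _ => rfl⟩
    (LinearEquiv.funUnique (PLift (X.label c ∈ I.carrier)) k k).symm.toFGModuleCatIso
  refine ⟨Paths.liftNatIso (fun c => e c) ?_⟩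
  intro c d α
  have h0 : ((tour X).obj (intervalRepresentation I)).map α.toPath =
      FGModuleCat.ofHom (indicatorMap k I.carrier (X.label c) (X.label d)) := by
    refine (Paths.lift_toPath _ α).trans ?_
    exact indicatorFunctor_map I.convex _
  rw [h0]
  refine FGModuleCat.hom_ext (LinearMap.ext_ring (funext fun h => ?_))
  change (1 : k) = indicatorMap k I.carrier (X.label c) (X.label d) (fun _ => 1) h
  rw [indicatorMap, dif_pos (hc c)]
  rfl

/-- Along a course in an interval which starts at `s` and ends at `t`, and all of whose vertices
lie between `s` and `t`, the multiplicity of the interval representation is the rank of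
`M(p)`. -/
theorem hasMultiplicity_tour (hQ : Quiver.IsAcyclic Q) (M : (fullCommutativity k Q).Representation)
    (I : (fullCommutativity k Q).Interval) (X : Course.{v, w, v', w'} Q)
    (hX : Set.range X.label ⊆ I.carrier) {s t : Q} (p : Quiver.Path s t)
    (hs : s ∈ Set.range X.label) (ht : t ∈ Set.range X.label)
    (hfrom : ∀ c, Nonempty (Quiver.Path s (X.label c)))
    (hto : ∀ c, Nonempty (Quiver.Path (X.label c) t)) :
    HasMultiplicity ((tour X).obj M) ((tour X).obj (intervalRepresentation I))
      (pathRank M p) := by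
  obtain ⟨a, rfl⟩ := hs
  obtain ⟨b, rfl⟩ := ht
  obtain ⟨e⟩ := nonempty_tour_intervalRepresentation_iso I X hX
  refine HasMultiplicity.of_iso ?_ e
  -- Independence of the path makes arbitrary choices of paths compatible: this gives the naturality
  -- of the cone `i` and the cocone `j`, and their composite.
  have hcomp {x y z : Q} (q : Quiver.Path x y) (r : Quiver.Path y z) (l : Quiver.Path x z) :
      M.obj.map q.hom ≫ M.obj.map r.hom = M.obj.map l.hom := by
    rw [← map_eq_map hQ M (q.comp r) l]
    exact (M.obj.map_comp q.hom r.hom).symm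
  -- This makes the leg of `i` at `a` and that of `j` at `b` identities.
  have hnil {x : Q} (q : Quiver.Path x x) : M.obj.map q.hom = 𝟙 _ := by
    rw [map_eq_map hQ M q .nil]
    exact M.obj.map_id _
  have harr {c d : X.C} (α : c ⟶ d) : ((tour X).obj M).map α.toPath =
      M.obj.map (X.exists_path α).some.hom := Paths.lift_toPath _ α
  let N := (tour X).obj M
  let i : (Functor.const (Paths X.C)).obj (N.obj ((Paths.of X.C).obj a)) ⟶ N :=
    Paths.liftNatTrans (fun c => M.obj.map (hfrom c).some.hom) (by
      intro c d α
      rw [harr]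
      exact (Category.id_comp _).trans (hcomp _ _ _).symm)
  let j : N ⟶ (Functor.const (Paths X.C)).obj (N.obj ((Paths.of X.C).obj b)) :=
    Paths.liftNatTrans (fun c => M.obj.map (hto c).some.hom) (by
      intro c d α
      rw [harr]
      exact (hcomp _ _ _).trans (Category.comp_id _).symm)
  have hij : i ≫ j = (Functor.const (Paths X.C)).map (M.obj.map p.hom) := by
    ext c : 2
    exact hcomp _ _ _
  have hi : i.app ((Paths.of X.C).obj a) = 𝟙 _ := hnil _
  have hj : j.app ((Paths.of X.C).obj b) = 𝟙 _ := hnil _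
  exact hasMultiplicity_const X.connected N a b (M.obj.map p.hom) i j hi hj hij

variable {s t : Q} (p : Quiver.Path s t) (hp : (fullCommutativity k Q).IsNonzeroPath p)

/-- Every vertex of the convex hull of the ends of a path from `s` to `t` is reached from `s` and
reaches `t`. -/
theorem nonempty_path_of_mem_hullInterval {c : Q} (hc : c ∈ (hullInterval p hp).carrier) :
    Nonempty (Quiver.Path s c) ∧ Nonempty (Quiver.Path c t) := by
  obtain ⟨x, y, q, hx, hy, -, hcq⟩ := hc
  obtain ⟨q₁, q₂, rfl⟩ := q.exists_eq_comp_of_mem_vertices hcq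
  constructor
  -- A path starting at `t` is preceded by `p`; dually, one ending at `s` is followed by `p`.
  · rcases hx with rfl | rfl
    · exact ⟨q₁⟩
    · exact ⟨p.comp q₁⟩
  · rcases hy with rfl | rfl
    · exact ⟨q₂.comp p⟩
    · exact ⟨q₂⟩

/-- In an acyclic quiver the ends of a path are essential vertices of its convex hull. -/
theorem ends_mem_essentialVertices_hullInterval (hQ : Quiver.IsAcyclic Q) :
    s ∈ (hullInterval p hp).essentialVertices ∧ t ∈ (hullInterval p hp).essentialVertices := by
  refine ⟨⟨⟨s, t, p, by simp, by simp, hp, p.start_mem_vertices⟩,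
    Or.inl fun c => ⟨fun (e : c.1 ⟶ s) => ?_⟩⟩,
    ⟨⟨s, t, p, by simp, by simp, hp, p.end_mem_vertices⟩,
    Or.inr fun c => ⟨fun (e : t ⟶ c.1) => ?_⟩⟩⟩
  -- An arrow into `s` from a vertex reached from `s` would close a nontrivial cycle; similarly at
  -- `t`.
  · obtain ⟨⟨q⟩, -⟩ := nonempty_path_of_mem_hullInterval p hp c.2
    simpa using hQ s (q.cons e)
  · obtain ⟨-, ⟨q⟩⟩ := nonempty_path_of_mem_hullInterval p hp c.2
    simpa using hQ t (e.toPath.comp q)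

end Tours

theorem mainTheorem2 {k : Type u} [Field k] {Q : Type v} [Quiver.{w} Q] [Finite Q]
    [∀ a b : Q, Finite (a ⟶ b)] (hQ : Quiver.IsAcyclic Q)
    (ξ : EssentialAssignment.{u, v, w, v', w'} (fullCommutativity k Q))
    (M : (fullCommutativity k Q).Representation) {s t : Q} (p : Quiver.Path s t)
    (hp : (fullCommutativity k Q).IsNonzeroPath p) :
    HasMultiplicity ((tour (ξ.course (hullInterval p hp))).obj M)
        ((tour (ξ.course (hullInterval p hp))).obj
          (intervalRepresentation (hullInterval p hp)))
        (compressedMultiplicity ξ M (hullInterval p hp)) ∧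
      compressedMultiplicity ξ M (hullInterval p hp) = pathRank M p := by
  obtain ⟨hess, hX⟩ := ξ.isEssentialIn (hullInterval p hp)
  -- Of all essential vertices only `s` and `t` are needed as labels; containment of the labels in
  -- the hull supplies the paths from `s` and to `t`.
  obtain ⟨hs, ht⟩ := ends_mem_essentialVertices_hullInterval p hp hQ
  have hpath c := nonempty_path_of_mem_hullInterval p hp (hX ⟨c, rfl⟩)
  exact hasMultiplicity_multiplicityOf (hasMultiplicity_tour hQ M _ _ hX p (hess hs) (hess ht)
    (fun c => (hpath c).1) fun c => (hpath c).2)
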